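/- All graphs are finite, simple and connected. A vertex $v$ of $G$ is a cut vertex if $G-v$ is not connected. A block of $G$ is a cut edge or a maximal $2$-connected subgraph, and a $k$-polygon is a cycle of length $k$. For $n\ge1$ and $k\ge3$ let $\mathcal G_{n,k}$ be the class of $k$-polygonal cacti with $n$ polygons, that is, of connected graphs in which every block is a $k$-polygon and which have exactly $n$ $k$-polygons. A cactus chain is a $k$-polygonal cactus in which each polygon contains at most two cut vertices and each cut vertex is the common vertex of exactly two polygons. Let $\mathcal A_{n,k}$ (respectively $\mathcal B_{n,k}$) be the class of those cactus chains in $\mathcal G_{n,k}$ in which any two distinct cut vertices lying on the same polygon are adjacent (respectively, are not adjacent). For real $\alpha,\beta$ put $$SO_\alpha(G;\beta)=\sum_{uv\in E(G)}\bigl(d(u)^\alpha+d(v)^\alpha\bigr)^\beta .$$ Let $n\ge3$, $k\ge3$ be integers, let $\alpha\ge1$ and $\beta>1$ be real, and let $G\in\mathcal G_{n,k}$. (i) If $k=3$, then $$SO_\alpha(G;\beta)\ \ge\ 2\,(2^{\alpha+1})^\beta+2n\,(4^\alpha+2^\alpha)^\beta+(n-2)\,(2\cdot4^\alpha)^\beta,$$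 with equality if and only if $G\in\mathcal A_{n,3}$. (ii) If $k\ge4$, then $$SO_\alpha(G;\beta)\ \ge\ (kn-4n+4)\,(2^{\alpha+1})^\beta+(4n-4)\,(4^\alpha+2^\alpha)^\beta,$$ with equality if $G\in\mathcal B_{n,k}$. Furthermore, if $k\in\{4,5\}$, then equality holds if and only if $G\in\mathcal B_{n,k}$. -/

import Mathlib

namespace PolygonalCactus

variable {V : Type*}

/-- `v` is a cut vertex of `G`: deleting `v` disconnects the graph. -/
def IsCutVertex (G : SimpleGraph V) (v : V) : Prop :=
  ¬ (G.induce ({v}ᶜ : Set V)).Preconnected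

/-- A graph is 2-connected if it has at least three vertices, is connected, and has no
cut vertex. -/
def IsTwoConnected (G : SimpleGraph V) : Prop :=
  3 ≤ ENat.card V ∧ G.Connected ∧ ∀ v, ¬ IsCutVertex G v

/-- A block of `G` is a cut edge (with its two ends) or a maximal 2-connected subgraph. -/
def IsBlock (G : SimpleGraph V) (B : G.Subgraph) : Prop :=
  (∃ (u v : V) (h : G.Adj u v), G.IsBridge s(u, v) ∧ B = G.subgraphOfAdj h) ∨
    Maximal (fun H : G.Subgraph => IsTwoConnected H.coe) B

/-- A `k`-polygon of `G` is a subgraph of `G` that is a cycle of length `k`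
(for `3 ≤ k`). -/
def IsPolygon (G : SimpleGraph V) (k : ℕ) (P : G.Subgraph) : Prop :=
  Nonempty (P.coe ≃g SimpleGraph.cycleGraph k)

/-- A `k`-polygonal cactus: a connected graph each of whose blocks is a `k`-polygon. -/
def IsPolygonalCactus (k : ℕ) (G : SimpleGraph V) : Prop :=
  G.Connected ∧ ∀ B : G.Subgraph, IsBlock G B → IsPolygon G k B

/-- The class `𝒢_{n,k}` of `k`-polygonal cacti with exactly `n` polygons. -/
def polygonalCacti (V : Type*) (n k : ℕ) : Set (SimpleGraph V) :=
  {G | IsPolygonalCactus k G ∧ {P : G.Subgraph | IsPolygon G k P}.ncard = n}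

/-- A cactus chain: a `k`-polygonal cactus in which each polygon has at most two cut vertices,
and each cut vertex is the common vertex of exactly two polygons. -/
def IsCactusChain (k : ℕ) (G : SimpleGraph V) : Prop :=
  IsPolygonalCactus k G ∧
    (∀ P : G.Subgraph, IsPolygon G k P → {v | v ∈ P.verts ∧ IsCutVertex G v}.ncard ≤ 2) ∧
    ∀ v, IsCutVertex G v → {P : G.Subgraph | IsPolygon G k P ∧ v ∈ P.verts}.ncard = 2

/-- The class `𝒜_{n,k}`: cactus chains with `n` polygons in which any two cut vertices on the same
polygon are adjacent. -/
def adjacentChains (V : Type*) (n k : ℕ) : Set (SimpleGraph V) :=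
  {G | G ∈ polygonalCacti V n k ∧ IsCactusChain k G ∧
    ∀ P : G.Subgraph, IsPolygon G k P → ∀ u ∈ P.verts, ∀ v ∈ P.verts,
      IsCutVertex G u → IsCutVertex G v → u ≠ v → G.Adj u v}

/-- The class `ℬ_{n,k}`: cactus chains with `n` polygons in which any two cut vertices on the same
polygon are not adjacent. -/
def nonadjacentChains (V : Type*) (n k : ℕ) : Set (SimpleGraph V) :=
  {G | G ∈ polygonalCacti V n k ∧ IsCactusChain k G ∧
    ∀ P : G.Subgraph, IsPolygon G k P → ∀ u ∈ P.verts, ∀ v ∈ P.verts,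
      IsCutVertex G u → IsCutVertex G v → u ≠ v → ¬ G.Adj u v}

/-- The general Sombor index `SO_α(G; β) = ∑_{uv ∈ E(G)} (d(u)^α + d(v)^α)^β`. -/
noncomputable def generalSombor [Fintype V] [DecidableEq V] (G : SimpleGraph V)
    [DecidableRel G.Adj] (α β : ℝ) : ℝ :=
  ∑ e ∈ G.edgeFinset,
    Sym2.lift ⟨fun u v => ((G.degree u : ℝ) ^ α + (G.degree v : ℝ) ^ α) ^ β,
      fun u v => by beta_reduce; rw [add_comm]⟩ e

end PolygonalCactus

/-! In a cactus the edges at a vertex `v` are partitioned by the polygons through `v`, two edges for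
each, so `d(v) = 2a` with `a` the number of polygons through `v`, and `v` is a cut vertex exactly
when `a ≥ 2`. The index is thus a sum of edge weights `F a b = ((2a)^α + (2b)^α)^β`, and only a few
convexity properties of `F` matter (`IsSupermodularWeight`).

The constraint on the numbers `a` is linear in the excess `1 - 1/a`. Deleting one edge per polygon
leaves a spanning tree, so `|V| = n(k-1) + 1`. Summing the excesses of both ends over all edges
gives `∑ (d(v) - 2) = 2|E| - 2|V| = 2(n-1)`, whatever the cactus (`sum_edge_excess`). Any lower
bound that is affine in the excess therefore sums to a constant.

For `k ≥ 4` the bound is taken edge by edge: `F a b` lies above the affine function that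
interpolates the pairs `1, 1` and `1, 2`, with equality only there (`edge_lt`, `edge_eq`,
`sum_weight_ge`). Equality means that every `a` is at most 2 and no two cut vertices are adjacent.

In a triangle two cut vertices are always adjacent, so for `k = 3` the bound is taken triangle by
triangle, interpolating `1, 1, 2` and `1, 2, 2` (`triangleGap_nonneg`, `triangleGap_eq_zero_iff`,
`sum_weight_ge_of_three`). -/

namespace PolygonalCactus

open SimpleGraph

/-! ### 2-connected subgraphs and cycles. -/

section Connectivity

variable {V W : Type*}

/-- Reachability is unchanged when a graph is transported along an injection. -/
lemma reachable_iff_of_injective {A : SimpleGraph W} {B : SimpleGraph V} {f : W → V}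
    (hf : Function.Injective f)
    (hB : ∀ a b, B.Adj a b ↔ ∃ x y, A.Adj x y ∧ f x = a ∧ f y = b) (x y : W) :
    B.Reachable (f x) (f y) ↔ A.Reachable x y := by
  constructor
  · have key : ∀ a b (_ : B.Walk a b) x, f x = a → ∀ y, f y = b → A.Reachable x y := by
      intro a b p
      induction p with
      | nil => rintro x rfl y hy; rw [hf hy]
      | cons h q ih =>
        rintro x rfl y rfl
        obtain ⟨x', y', hxy, hx, rfl⟩ := (hB _ _).1 h
        rw [← hf hx]
        exact hxy.reachable.trans (ih _ rfl _ rfl)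
    rintro ⟨p⟩
    exact key _ _ p x rfl y rfl
  · rintro ⟨p⟩
    induction p with
    | nil => rfl
    | cons h q ih => exact (((hB _ _).2 ⟨_, _, h, rfl, rfl⟩ : B.Adj _ _).reachable).trans ih

/-- Isolating `v` instead of removing it keeps the vertex type fixed, so that graphs with different
deletions can be compared by `≤`. -/
lemma not_isCutVertex_iff (G : SimpleGraph V) (v : V) :
    ¬ IsCutVertex G v ↔ ∀ x y, x ≠ v → y ≠ v → (G.deleteIncidenceSet v).Reachable x y := by
  have h := reachable_iff_of_injective (A := G.induce ({v}ᶜ : Set V))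
    (B := G.deleteIncidenceSet v) (f := Subtype.val) Subtype.val_injective (by
      intro a b
      rw [deleteIncidenceSet_adj]
      constructor
      · rintro ⟨hab, ha, hb⟩
        exact ⟨⟨a, ha⟩, ⟨b, hb⟩, hab, rfl, rfl⟩
      · rintro ⟨x, y, hxy, rfl, rfl⟩
        exact ⟨hxy, x.2, y.2⟩)
  rw [IsCutVertex, not_not]
  exact ⟨fun H x y hx hy => (h ⟨x, hx⟩ ⟨y, hy⟩).2 (H _ _),
    fun H x y => (h x y).1 (H _ _ x.2 y.2)⟩

/-- A subgraph is 2-connected if it has at least three vertices and any two of them stay linked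
after deleting any other vertex. -/
lemma isTwoConnected_coe_iff {G : SimpleGraph V} (H : G.Subgraph) :
    IsTwoConnected H.coe ↔ 3 ≤ H.verts.encard ∧ ∀ v, ∀ x ∈ H.verts, ∀ y ∈ H.verts, x ≠ v → y ≠ v →
      (H.spanningCoe.deleteIncidenceSet v).Reachable x y := by
  have h1 := reachable_iff_of_injective (A := H.coe) (B := H.spanningCoe) (f := Subtype.val)
    Subtype.val_injective (by
      intro a b
      constructor
      · intro hab
        exact ⟨⟨a, H.edge_vert hab⟩, ⟨b, H.edge_vert hab.symm⟩, hab, rfl, rfl⟩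
      · rintro ⟨x, y, hxy, rfl, rfl⟩
        exact hxy)
  have h2 : ∀ v : H.verts, ∀ x y : H.verts,
      (H.spanningCoe.deleteIncidenceSet v).Reachable x y ↔
        (H.coe.deleteIncidenceSet v).Reachable x y := by
    intro v
    apply reachable_iff_of_injective (f := Subtype.val) Subtype.val_injective
    intro a b
    simp only [deleteIncidenceSet_adj]
    constructor
    · rintro ⟨hab, ha, hb⟩
      exact ⟨⟨a, H.edge_vert hab⟩, ⟨b, H.edge_vert hab.symm⟩,
        ⟨hab, fun h => ha (congrArg Subtype.val h), fun h => hb (congrArg Subtype.val h)⟩, rfl, rfl⟩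
    · rintro ⟨x, y, ⟨hxy, hx, hy⟩, rfl, rfl⟩
      exact ⟨hxy, fun h => hx (Subtype.ext h), fun h => hy (Subtype.ext h)⟩
  have h3 : ∀ v ∉ H.verts, H.spanningCoe.deleteIncidenceSet v = H.spanningCoe := by
    intro v hv
    ext a b
    rw [deleteIncidenceSet_adj]
    refine ⟨fun h => h.1, fun h => ⟨h, ?_, ?_⟩⟩
    · rintro rfl; exact hv (H.edge_vert h)
    · rintro rfl; exact hv (H.edge_vert h.symm)
  have hcard : ENat.card H.verts = H.verts.encard := rfl
  unfold IsTwoConnected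
  simp_rw [not_isCutVertex_iff, hcard]
  constructor
  · rintro ⟨hc, hconn, hcut⟩
    refine ⟨hc, fun v x hx y hy hxv hyv => ?_⟩
    by_cases hv : v ∈ H.verts
    · exact (h2 ⟨v, hv⟩ ⟨x, hx⟩ ⟨y, hy⟩).2 (hcut _ _ _ (fun h => hxv (congrArg Subtype.val h))
        (fun h => hyv (congrArg Subtype.val h)))
    · rw [h3 v hv]
      exact (h1 ⟨x, hx⟩ ⟨y, hy⟩).2 (hconn.preconnected _ _)
  · rintro ⟨hc, hr⟩
    refine ⟨hc, ?_, fun v x y hx hy => ?_⟩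
    · have hne : H.verts.Nonempty := by
        rw [← Set.encard_ne_zero]
        intro h
        rw [h] at hc
        simp at hc
      have := hne.to_subtype
      refine ⟨fun x y => ?_⟩
      -- A third vertex `z` exists; `x` and `y` are linked even after deleting it, hence linked.
      obtain ⟨z, hz, hzxy⟩ : ∃ z ∈ H.verts, z ∉ ({x.1, y.1} : Set V) := by
        by_contra! hcon
        have h1 : H.verts.encard ≤ ({x.1, y.1} : Set V).encard := Set.encard_le_encard hcon
        have := (hc.trans h1).trans (Set.encard_insert_le _ _)
        rw [Set.encard_singleton] at this
        norm_num at this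
      simp only [Set.mem_insert_iff, Set.mem_singleton_iff, not_or] at hzxy
      exact (h1 x y).1 ((hr z x x.2 y y.2 (Ne.symm hzxy.1) (Ne.symm hzxy.2)).mono
        (deleteIncidenceSet_le _ _))
    · exact (h2 v x y).1 (hr v x x.2 y y.2 (fun h => hx (Subtype.ext h))
        (fun h => hy (Subtype.ext h)))

/-- The union of two 2-connected subgraphs with two common vertices is 2-connected. -/
lemma IsTwoConnected.sup {G : SimpleGraph V} {H K : G.Subgraph} (hH : IsTwoConnected H.coe)
    (hK : IsTwoConnected K.coe) {a b : V} (hab : a ≠ b) (haH : a ∈ H.verts) (hbH : b ∈ H.verts)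
    (haK : a ∈ K.verts) (hbK : b ∈ K.verts) : IsTwoConnected (H ⊔ K).coe := by
  rw [isTwoConnected_coe_iff] at *
  refine ⟨hH.1.trans (Set.encard_le_encard Set.subset_union_left), fun v => ?_⟩
  -- One of the two common vertices survives the deletion of `v` and serves as a hub.
  obtain ⟨c, hcv, hcH, hcK⟩ : ∃ c, c ≠ v ∧ c ∈ H.verts ∧ c ∈ K.verts := by
    by_cases h : a = v
    · exact ⟨b, fun h' => hab (h.trans h'.symm), hbH, hbK⟩
    · exact ⟨a, h, haH, haK⟩
  have hle : ∀ {A B : G.Subgraph}, A ≤ B →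
      A.spanningCoe.deleteIncidenceSet v ≤ B.spanningCoe.deleteIncidenceSet v := by
    intro A B hAB x y hxy
    rw [deleteIncidenceSet_adj] at *
    exact ⟨hAB.2 hxy.1, hxy.2⟩
  have key : ∀ x ∈ (H ⊔ K).verts, x ≠ v →
      ((H ⊔ K).spanningCoe.deleteIncidenceSet v).Reachable x c := by
    rintro x (hx | hx) hxv
    · exact (hH.2 v x hx c hcH hxv hcv).mono (hle le_sup_left)
    · exact (hK.2 v x hx c hcK hxv hcv).mono (hle le_sup_right)
  exact fun x hx y hy hxv hyv => (key x hx hxv).trans (key y hy hyv).symm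

lemma reachable_of_forall_mem_edges_adj {G : SimpleGraph V} {B : SimpleGraph V} {x y : V}
    (p : G.Walk x y) (h : ∀ a b, s(a, b) ∈ p.edges → B.Adj a b) : B.Reachable x y :=
  ⟨p.transfer B (fun e he => by
    induction e with
    | _ a b => exact h a b he)⟩

/-- The subgraph of a cycle is 2-connected. -/
lemma isTwoConnected_of_isCycle {G : SimpleGraph V} {u : V} {c : G.Walk u u} (hc : c.IsCycle) :
    IsTwoConnected c.toSubgraph.coe := by
  classical
  rw [isTwoConnected_coe_iff]
  refine ⟨?_, fun v => ?_⟩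
  · have h1 : c.support.tail.toFinset.card = c.length := by
      rw [List.toFinset_card_of_nodup hc.support_nodup, List.length_tail, Walk.length_support]
      rfl
    have h2 : (c.support.tail.toFinset : Set V) ⊆ c.toSubgraph.verts := by
      intro x hx
      rw [Walk.mem_verts_toSubgraph]
      exact List.mem_of_mem_tail (by simpa using hx)
    refine le_trans ?_ (Set.encard_le_encard h2)
    rw [Set.encard_coe_eq_coe_finsetCard, h1]
    exact_mod_cast hc.three_le_length
  · by_cases hv : v ∈ c.support
    -- With the cycle based at the deleted vertex, its tail is a path meeting `v` only at the end,
    -- so all other vertices are linked along it.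
    · set d := c.rotate v hv with hd
      have hdc : d.IsCycle := hc.rotate hv
      have hsub : d.toSubgraph = c.toSubgraph := Walk.toSubgraph_rotate c hv
      rw [← hsub]
      have hlast : ∀ x ∈ d.toSubgraph.verts, x ≠ v →
          (d.toSubgraph.spanningCoe.deleteIncidenceSet v).Reachable d.snd x := by
        intro x hx hxv
        rw [Walk.mem_verts_toSubgraph] at hx
        have hpath := hdc.isPath_tail
        have hxt : x ∈ d.tail.support := by
          rw [Walk.support_tail_of_not_nil _ hdc.not_nil]
          exact (Walk.mem_support_iff _).1 hx |>.resolve_left hxv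
        refine reachable_of_forall_mem_edges_adj (d.tail.takeUntil x hxt) fun a b hab => ?_
        rw [deleteIncidenceSet_adj]
        have hvt : v ∉ (d.tail.takeUntil x hxt).support :=
          Walk.endpoint_notMem_support_takeUntil hpath hxt hxv.symm
        refine ⟨?_, ?_, ?_⟩
        · rw [Subgraph.spanningCoe_adj, Walk.adj_toSubgraph_iff_mem_edges]
          have := d.tail.edges_takeUntil_subset_edges hxt hab
          rw [Walk.edges_tail] at this
          exact List.mem_of_mem_tail this
        · rintro rfl; exact hvt (Walk.fst_mem_support_of_mem_edges _ hab)
        · rintro rfl; exact hvt (Walk.snd_mem_support_of_mem_edges _ hab)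
      exact fun x hx y hy hxv hyv => (hlast x hx hxv).symm.trans (hlast y hy hyv)
    · intro x hx y hy _ _
      have hle : c.toSubgraph.spanningCoe.deleteIncidenceSet v = c.toSubgraph.spanningCoe := by
        ext a b
        rw [deleteIncidenceSet_adj]
        refine ⟨fun h => h.1, fun h => ⟨h, ?_, ?_⟩⟩
        · rintro rfl; exact hv ((Walk.mem_verts_toSubgraph _).1 (c.toSubgraph.edge_vert h))
        · rintro rfl; exact hv ((Walk.mem_verts_toSubgraph _).1 (c.toSubgraph.edge_vert h.symm))
      rw [hle]
      have hu : ∀ x ∈ c.toSubgraph.verts, c.toSubgraph.spanningCoe.Reachable u x := by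
        intro x hx
        rw [Walk.mem_verts_toSubgraph] at hx
        refine reachable_of_forall_mem_edges_adj (c.takeUntil x hx) fun a b hab => ?_
        rw [Subgraph.spanningCoe_adj, Walk.adj_toSubgraph_iff_mem_edges]
        exact c.edges_takeUntil_subset_edges hx hab
      exact (hu x hx).symm.trans (hu y hy)

/-- In a connected 2-regular subgraph every nonempty 2-regular subgraph is everything. -/
lemma eq_of_le_of_two_regular [Finite V] {G : SimpleGraph V} {H K : G.Subgraph} (hle : H ≤ K)
    (hne : H.verts.Nonempty) (hH : ∀ v ∈ H.verts, (H.neighborSet v).ncard = 2)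
    (hK : ∀ v ∈ K.verts, (K.neighborSet v).ncard = 2)
    (hconn : ∀ x ∈ K.verts, ∀ y ∈ K.verts, K.spanningCoe.Reachable x y) : H = K := by
  -- Equal degrees force equal neighbourhoods, so a walk in `K` can never leave `H`.
  have hnb : ∀ v ∈ H.verts, H.neighborSet v = K.neighborSet v := fun v hv =>
    Set.eq_of_subset_of_ncard_le (fun w hw => hle.2 hw) (by rw [hH v hv, hK v (hle.1 hv)])
      (Set.toFinite _)
  have hadj : ∀ v ∈ H.verts, ∀ w, K.Adj v w → H.Adj v w := fun v hv w hw => by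
    have : w ∈ H.neighborSet v := by rw [hnb v hv]; exact hw
    exact this
  obtain ⟨a, ha⟩ := hne
  have hwalk : ∀ x y, ∀ _ : K.spanningCoe.Walk x y, x ∈ H.verts → y ∈ H.verts := by
    intro x y p
    induction p with
    | nil => exact id
    | cons h q ih => exact fun hx => ih (H.edge_vert (hadj _ hx _ h).symm)
  have hverts : H.verts = K.verts := by
    refine Set.Subset.antisymm hle.1 fun x hx => ?_
    obtain ⟨p⟩ := hconn a (hle.1 ha) x hx
    exact hwalk _ _ p ha
  refine le_antisymm hle ⟨hverts.ge, fun x y hxy => ?_⟩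
  exact hadj x (hverts ▸ K.edge_vert hxy) y hxy

end Connectivity

/-! ### Polygons as connected 2-regular subgraphs. -/

section Polygons

variable {V : Type*} {G : SimpleGraph V} {k : ℕ} {P Q : G.Subgraph}

lemma IsPolygon.ncard_verts (hP : IsPolygon G k P) : P.verts.ncard = k := by
  obtain ⟨e⟩ := hP
  rw [← Nat.card_coe_set_eq, Nat.card_congr e.toEquiv, Nat.card_fin]

lemma degree_cycleGraph (hk : 3 ≤ k) (v : Fin k) : (cycleGraph k).degree v = 2 := by
  obtain ⟨m, rfl⟩ := Nat.exists_eq_add_of_le' hk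
  exact cycleGraph_degree_three_le

lemma card_edgeFinset_cycleGraph (hk : 3 ≤ k) : (cycleGraph k).edgeFinset.card = k := by
  have := (cycleGraph k).sum_degrees_eq_twice_card_edges
  simp only [degree_cycleGraph hk, Finset.sum_const, Finset.card_univ, Fintype.card_fin,
    smul_eq_mul] at this
  omega

lemma IsPolygon.ncard_neighborSet (hk : 3 ≤ k) (hP : IsPolygon G k P) {v : V} (hv : v ∈ P.verts) :
    (P.neighborSet v).ncard = 2 := by
  obtain ⟨e⟩ := hP
  rw [← Nat.card_coe_set_eq, ← Nat.card_congr (Subgraph.coeNeighborSetEquiv (⟨v, hv⟩ : P.verts)),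
    Nat.card_congr (e.mapNeighborSet _), Nat.card_eq_fintype_card, card_neighborSet_eq_degree,
    degree_cycleGraph hk]

lemma IsPolygon.ncard_edgeSet (hk : 3 ≤ k) (hP : IsPolygon G k P) : P.edgeSet.ncard = k := by
  obtain ⟨e⟩ := hP
  rw [← Subgraph.image_coe_edgeSet_coe,
    Set.ncard_image_of_injective _ (Sym2.map.injective Subtype.val_injective),
    ← Nat.card_coe_set_eq, Nat.card_congr e.mapEdgeSet, Nat.card_eq_fintype_card,
    ← edgeFinset_card, card_edgeFinset_cycleGraph hk]

lemma IsPolygon.reachable (hP : IsPolygon G k P) {x y : V} (hx : x ∈ P.verts)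
    (hy : y ∈ P.verts) : P.spanningCoe.Reachable x y := by
  obtain ⟨e⟩ := hP
  obtain ⟨p⟩ : P.coe.Reachable ⟨x, hx⟩ ⟨y, hy⟩ := by
    rw [← e.reachable_iff]
    exact cycleGraph_preconnected _ _
  exact ⟨p.map P.coeEmbeddingSpanningCoe.toHom⟩

lemma IsPolygon.exists_isCycle [Finite V] (hk : 3 ≤ k) (hP : IsPolygon G k P) :
    ∃ (u : V) (c : G.Walk u u), c.IsCycle ∧ c.toSubgraph = P := by
  have hP' := hP
  obtain ⟨e⟩ := hP
  obtain ⟨m, rfl⟩ := Nat.exists_eq_add_of_le' hk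
  set f : cycleGraph (m + 3) →g P.coe := e.symm.toHom
  set c' : P.coe.Walk (f 0) (f 0) := (cycleGraph.cycle m).map f
  have hc' : c'.IsCycle := (cycleGraph.isCycle_cycle).map e.symm.injective
  have hc : (c'.map P.hom).IsCycle := hc'.map Subgraph.hom_injective
  refine ⟨_, c'.map P.hom, hc, eq_of_le_of_two_regular ?_ ⟨_, Walk.start_mem_verts_toSubgraph _⟩
    (fun v hv => hc.ncard_neighborSet_toSubgraph_eq_two ((Walk.mem_verts_toSubgraph _).1 hv))
    (fun v hv => hP'.ncard_neighborSet hk hv) (fun x hx y hy => hP'.reachable hx hy)⟩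
  rw [Walk.toSubgraph_map]
  exact (Subgraph.map_mono le_top).trans (Subgraph.map_hom_top P).le

lemma IsPolygon.isTwoConnected [Finite V] (hk : 3 ≤ k) (hP : IsPolygon G k P) :
    IsTwoConnected P.coe := by
  obtain ⟨u, c, hc, rfl⟩ := hP.exists_isCycle hk
  exact isTwoConnected_of_isCycle hc

lemma IsPolygon.eq_of_le [Finite V] (hk : 3 ≤ k) (hP : IsPolygon G k P) (hQ : IsPolygon G k Q)
    (hle : P ≤ Q) : P = Q := by
  refine eq_of_le_of_two_regular hle ?_ (fun v hv => hP.ncard_neighborSet hk hv)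
    (fun v hv => hQ.ncard_neighborSet hk hv) (fun x hx y hy => hQ.reachable hx hy)
  apply Set.nonempty_of_ncard_ne_zero
  rw [hP.ncard_verts]
  omega

end Polygons

/-! ### Each edge of a cactus lies on exactly one polygon. -/

section Structure

variable {V : Type*} [Finite V] {G : SimpleGraph V} {k : ℕ} {P Q : G.Subgraph}

namespace IsPolygonalCactus

lemma exists_isPolygon_ge (hG : IsPolygonalCactus k G) {H : G.Subgraph}
    (hH : IsTwoConnected H.coe) : ∃ P, IsPolygon G k P ∧ H ≤ P ∧
      Maximal (fun H : G.Subgraph => IsTwoConnected H.coe) P := by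
  obtain ⟨P, hle, hP⟩ := Finite.exists_le_maximal (p := fun H : G.Subgraph => IsTwoConnected H.coe) hH
  exact ⟨P, hG.2 P (Or.inr hP), hle, hP⟩

lemma maximal (hk : 3 ≤ k) (hG : IsPolygonalCactus k G) (hP : IsPolygon G k P) :
    Maximal (fun H : G.Subgraph => IsTwoConnected H.coe) P := by
  obtain ⟨Q, hQ, hle, hmax⟩ := hG.exists_isPolygon_ge (hP.isTwoConnected hk)
  rwa [hP.eq_of_le hk hQ hle]

/-- Two polygons of a cactus with two common vertices coincide. -/
lemma eq_of_two_common (hk : 3 ≤ k) (hG : IsPolygonalCactus k G) (hP : IsPolygon G k P)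
    (hQ : IsPolygon G k Q) {a b : V} (hab : a ≠ b) (haP : a ∈ P.verts) (hbP : b ∈ P.verts)
    (haQ : a ∈ Q.verts) (hbQ : b ∈ Q.verts) : P = Q := by
  have hsup := (hP.isTwoConnected hk).sup (hQ.isTwoConnected hk) hab haP hbP haQ hbQ
  rw [(hG.maximal hk hP).eq_of_le hsup le_sup_left]
  exact ((hG.maximal hk hQ).eq_of_le hsup le_sup_right).symm

/-- A cycle is 2-connected, so it sits inside a block, which is a polygon; a 2-regular subgraph of a
polygon fills it. -/
lemma isPolygon_of_isCycle (hk : 3 ≤ k) (hG : IsPolygonalCactus k G) {u : V} {c : G.Walk u u}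
    (hc : c.IsCycle) : IsPolygon G k c.toSubgraph := by
  obtain ⟨P, hP, hle, -⟩ := hG.exists_isPolygon_ge (isTwoConnected_of_isCycle hc)
  rwa [eq_of_le_of_two_regular hle ⟨_, Walk.start_mem_verts_toSubgraph _⟩
    (fun v hv => hc.ncard_neighborSet_toSubgraph_eq_two ((Walk.mem_verts_toSubgraph _).1 hv))
    (fun v hv => hP.ncard_neighborSet hk hv) (fun x hx y hy => hP.reachable hx hy)]

/-- A bridge would be a block with two vertices, too few for a polygon. Hence every edge is on a
cycle, and two polygons sharing its ends coincide. -/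
lemma existsUnique_isPolygon_adj (hk : 3 ≤ k) (hG : IsPolygonalCactus k G) {a b : V}
    (hab : G.Adj a b) : ∃! P : G.Subgraph, IsPolygon G k P ∧ P.Adj a b := by
  have hnb : ¬ G.IsBridge s(a, b) := by
    intro hb
    have := (hG.2 _ (Or.inl ⟨a, b, hab, hb, rfl⟩)).ncard_verts
    rw [subgraphOfAdj_verts] at this
    have h2 := Set.ncard_insert_le a {b}
    rw [Set.ncard_singleton] at h2
    omega
  rw [isBridge_iff_forall_cycle_notMem (G.mem_edgeSet.2 hab)] at hnb
  push Not at hnb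
  obtain ⟨u, c, hc, hmem⟩ := hnb
  refine ⟨c.toSubgraph, ⟨hG.isPolygon_of_isCycle hk hc, c.adj_toSubgraph_iff_mem_edges.2 hmem⟩, ?_⟩
  rintro Q ⟨hQ, hQab⟩
  have hcab := c.adj_toSubgraph_iff_mem_edges.2 hmem
  exact hG.eq_of_two_common hk hQ (hG.isPolygon_of_isCycle hk hc) hab.ne (Q.edge_vert hQab)
    (Q.edge_vert hQab.symm) (c.toSubgraph.edge_vert hcab) (c.toSubgraph.edge_vert hcab.symm)

end IsPolygonalCactus

/-- The number of `k`-polygons containing `v`. -/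
noncomputable def polygonCount (G : SimpleGraph V) (k : ℕ) (v : V) : ℕ :=
  {P : G.Subgraph | IsPolygon G k P ∧ v ∈ P.verts}.ncard

namespace IsPolygonalCactus

lemma ncard_neighborSet_eq (hk : 3 ≤ k) (hG : IsPolygonalCactus k G) (v : V) :
    (G.neighborSet v).ncard = 2 * polygonCount G k v := by
  classical
  have := Fintype.ofFinite V
  have := Fintype.ofFinite G.Subgraph
  have hadj := fun w (hw : G.Adj v w) => hG.existsUnique_isPolygon_adj hk hw
  choose! f hf hfu using hadj
  rw [polygonCount, Set.ncard_eq_toFinset_card', Set.ncard_eq_toFinset_card']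
  rw [Finset.card_eq_sum_card_fiberwise (f := f)
    (t := {P : G.Subgraph | IsPolygon G k P ∧ v ∈ P.verts}.toFinset)]
  · rw [Finset.sum_const_nat (m := 2), mul_comm]
    intro P hP
    simp only [Set.mem_toFinset, Set.mem_ofPred_eq] at hP
    rw [← hP.1.ncard_neighborSet hk hP.2, Set.ncard_eq_toFinset_card']
    congr 1
    ext w
    simp only [Finset.mem_filter, Set.mem_toFinset, mem_neighborSet, Subgraph.mem_neighborSet]
    constructor
    · rintro ⟨hw, rfl⟩; exact (hf w hw).2
    · exact fun hw => ⟨hw.adj_sub, (hfu w hw.adj_sub P ⟨hP.1, hw⟩).symm⟩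
  · intro w hw
    simp only [Set.coe_toFinset, mem_neighborSet, Set.mem_ofPred_eq] at hw ⊢
    exact ⟨(hf w hw).1, (f w).edge_vert (hf w hw).2⟩

lemma sum_edgeFinset_eq [Fintype V] [DecidableRel G.Adj] {M : Type*} [AddCommMonoid M] (hk : 3 ≤ k)
    (hG : IsPolygonalCactus k G) (g : Sym2 V → M) :
    ∑ e ∈ G.edgeFinset, g e = ∑ P ∈ (Set.toFinite {P : G.Subgraph | IsPolygon G k P}).toFinset,
      ∑ e ∈ (Set.toFinite P.edgeSet).toFinset, g e := by
  classical
  have hadj : ∀ e ∈ G.edgeFinset, ∃! P : G.Subgraph, IsPolygon G k P ∧ e ∈ P.edgeSet := by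
    intro e he
    induction e with
    | _ a b => exact hG.existsUnique_isPolygon_adj hk (mem_edgeFinset.1 he)
  choose! f hf hfu using hadj
  rw [← Finset.sum_fiberwise_of_maps_to (g := f)
    (t := (Set.toFinite {P : G.Subgraph | IsPolygon G k P}).toFinset)
    (fun e he => by simpa using (hf e he).1)]
  refine Finset.sum_congr rfl fun P hP => Finset.sum_congr ?_ fun _ _ => rfl
  simp only [Set.Finite.mem_toFinset, Set.mem_ofPred_eq] at hP
  ext e
  simp only [Finset.mem_filter, Set.Finite.mem_toFinset]
  constructor
  · rintro ⟨he, rfl⟩; exact (hf e he).2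
  · intro he
    have he' : e ∈ G.edgeFinset := mem_edgeFinset.2 (P.edgeSet_subset he)
    exact ⟨he', (hfu e he' P ⟨hP, he⟩).symm⟩

lemma card_edgeFinset [Fintype V] [DecidableRel G.Adj] (hk : 3 ≤ k)
    (hG : IsPolygonalCactus k G) :
    G.edgeFinset.card = {P : G.Subgraph | IsPolygon G k P}.ncard * k := by
  rw [Finset.card_eq_sum_ones, hG.sum_edgeFinset_eq hk,
    Set.ncard_eq_toFinset_card _ (Set.toFinite _)]
  apply Finset.sum_const_nat
  intro P hP
  simp only [Set.Finite.mem_toFinset, Set.mem_ofPred_eq] at hP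
  rw [← Finset.card_eq_sum_ones, ← Set.ncard_eq_toFinset_card, hP.ncard_edgeSet hk]

end IsPolygonalCactus
end Structure
-- Cut vertices and the number of vertices.
section Counting

variable {V : Type*} {G : SimpleGraph V} {k : ℕ}

lemma exists_adj_reachable_deleteIncidenceSet (hG : G.Connected) {v x : V} (hx : x ≠ v) :
    ∃ w, G.Adj v w ∧ (G.deleteIncidenceSet v).Reachable w x := by
  classical
  obtain ⟨p, hp⟩ := (hG.preconnected v x).exists_isPath
  cases p with
  | nil => exact absurd rfl hx
  | cons h q =>
    rw [Walk.cons_isPath_iff] at hp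
    refine ⟨_, h, reachable_of_forall_mem_edges_adj q fun a b hab => ?_⟩
    rw [deleteIncidenceSet_adj]
    refine ⟨q.adj_of_mem_edges hab, ?_, ?_⟩
    · rintro rfl; exact hp.2 (Walk.fst_mem_support_of_mem_edges _ hab)
    · rintro rfl; exact hp.2 (Walk.snd_mem_support_of_mem_edges _ hab)

namespace IsPolygonalCactus

variable [Finite V]

lemma polygonCount_pos [Nontrivial V] (hk : 3 ≤ k) (hG : IsPolygonalCactus k G) (v : V) :
    0 < polygonCount G k v := by
  obtain ⟨x, hx⟩ := exists_ne v
  obtain ⟨w, hw, -⟩ := exists_adj_reachable_deleteIncidenceSet hG.1 hx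
  obtain ⟨P, ⟨hP, hPw⟩, -⟩ := hG.existsUnique_isPolygon_adj hk hw
  exact (Set.ncard_pos (Set.toFinite _)).2 ⟨P, hP, P.edge_vert hPw⟩

/-- If `v` is on one polygon only, all paths out of `v` start in it, and it stays connected without
`v`. If `v` is on two, a path avoiding `v` from a neighbour in one to a neighbour in the other would
close up to a cycle through `v`, a polygon sharing two vertices with each, so the two would
coincide. -/
lemma isCutVertex_iff (hk : 3 ≤ k) (hG : IsPolygonalCactus k G) (v : V) :
    IsCutVertex G v ↔ 2 ≤ polygonCount G k v := by
  classical
  constructor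
  · contrapose
    intro hb
    rw [not_isCutVertex_iff]
    intro x y hx hy
    have hb' : polygonCount G k v ≤ 1 := by omega
    rw [polygonCount, Set.ncard_le_one_iff] at hb'
    obtain ⟨a, ha, hax⟩ := exists_adj_reachable_deleteIncidenceSet hG.1 hx
    obtain ⟨b, hb, hby⟩ := exists_adj_reachable_deleteIncidenceSet hG.1 hy
    obtain ⟨P, ⟨hP, hPa⟩, -⟩ := hG.existsUnique_isPolygon_adj hk ha
    obtain ⟨Q, ⟨hQ, hQb⟩, -⟩ := hG.existsUnique_isPolygon_adj hk hb
    obtain rfl : P = Q := hb' ⟨hP, P.edge_vert hPa⟩ ⟨hQ, Q.edge_vert hQb⟩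
    refine hax.symm.trans (Reachable.trans ?_ hby)
    refine (((isTwoConnected_coe_iff P).1 (hP.isTwoConnected hk)).2 v a (P.edge_vert hPa.symm) b
      (P.edge_vert hQb.symm) ha.ne' hb.ne').mono ?_
    intro c d hcd
    rw [deleteIncidenceSet_adj] at *
    exact ⟨P.adj_sub hcd.1, hcd.2⟩
  · intro hb
    by_contra hcut
    have hr := (not_isCutVertex_iff G v).1 hcut
    obtain ⟨P, Q, ⟨hP, hvP⟩, ⟨hQ, hvQ⟩, hPQ⟩ := (Set.one_lt_ncard_iff (Set.toFinite _)).1 hb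
    obtain ⟨x, hx⟩ : (P.neighborSet v).Nonempty :=
      Set.nonempty_of_ncard_ne_zero (by rw [hP.ncard_neighborSet hk hvP]; omega)
    obtain ⟨y, hy⟩ : (Q.neighborSet v).Nonempty :=
      Set.nonempty_of_ncard_ne_zero (by rw [hQ.ncard_neighborSet hk hvQ]; omega)
    have hx : P.Adj v x := hx
    have hy : Q.Adj v y := hy
    have hxy : x ≠ y := by
      rintro rfl
      exact hPQ (hG.eq_of_two_common hk hP hQ hx.ne hvP (P.edge_vert hx.symm) hvQ
        (Q.edge_vert hy.symm))
    obtain ⟨p, hp⟩ := (hr x y (P.adj_sub hx).ne' (Q.adj_sub hy).ne').exists_isPath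
    set q := p.mapLe (deleteIncidenceSet_le G v) with hq
    have hqp : q.IsPath := (Walk.isPath_mapLe _).2 hp
    have hpath : ∀ a b (r : (G.deleteIncidenceSet v).Walk a b), a ≠ v → v ∉ r.support := by
      intro a b r
      induction r with
      | nil => intro ha; simpa using ha.symm
      | cons h r ih =>
        intro ha
        rw [deleteIncidenceSet_adj] at h
        simp only [Walk.support_cons, List.mem_cons, not_or]
        exact ⟨ha.symm, ih h.2.2⟩
    have hvq : v ∉ q.support := by
      rw [hq, Walk.support_mapLe_eq_support]
      exact hpath _ _ p (P.adj_sub hx).ne'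
    have hyv : G.Adj y v := (Q.adj_sub hy).symm
    have hvx : G.Adj v x := P.adj_sub hx
    have hc : (Walk.cons hvx (q.concat hyv)).IsCycle := by
      rw [Walk.cons_isCycle_iff]
      refine ⟨hqp.concat hvq hyv, ?_⟩
      rw [Walk.edges_concat, List.concat_eq_append, List.mem_append, List.mem_singleton, not_or]
      refine ⟨fun h => hvq (Walk.fst_mem_support_of_mem_edges _ h), ?_⟩
      rw [Sym2.eq_swap, Sym2.congr_left]
      exact hxy
    have hR := hG.isPolygon_of_isCycle hk hc
    have hmem : ∀ z ∈ q.support, z ∈ (Walk.cons hvx (q.concat hyv)).toSubgraph.verts := by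
      intro z hz
      rw [Walk.mem_verts_toSubgraph, Walk.support_cons, Walk.support_concat]
      exact List.mem_cons_of_mem _ (by simp [hz])
    have hv := Walk.start_mem_verts_toSubgraph (Walk.cons hvx (q.concat hyv))
    exact hPQ ((hG.eq_of_two_common hk hP hR hx.ne hvP (P.edge_vert hx.symm) hv
      (hmem x q.start_mem_support)).trans (hG.eq_of_two_common hk hQ hR hy.ne hvQ
      (Q.edge_vert hy.symm) hv (hmem y q.end_mem_support)).symm)

/-- Deleting one edge from each polygon of a cactus leaves a spanning tree. -/
lemma isTree_deleteEdges (hk : 3 ≤ k) (hG : IsPolygonalCactus k G) {f : G.Subgraph → Sym2 V}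
    (hf : ∀ P, IsPolygon G k P → f P ∈ P.edgeSet) :
    (G.deleteEdges (f '' {P | IsPolygon G k P})).IsTree := by
  classical
  have hinj : ∀ P, IsPolygon G k P → ∀ Q, IsPolygon G k Q → f Q ∈ P.edgeSet → Q = P := by
    intro P hP Q hQ h
    have h' := hf Q hQ
    revert h h'
    generalize f Q = e
    induction e with
    | _ a b =>
      intro h h'
      exact (hG.existsUnique_isPolygon_adj hk (P.adj_sub h)).unique ⟨hQ, h'⟩ ⟨hP, h⟩
  set T := G.deleteEdges (f '' {P | IsPolygon G k P}) with hT
  have hadj : ∀ a b, G.Adj a b → T.Reachable a b := by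
    intro a b hab
    by_cases hS : s(a, b) ∈ f '' {P | IsPolygon G k P}
    · obtain ⟨P, hP, hPe⟩ := hS
      have hP : IsPolygon G k P := hP
      obtain ⟨u, c, hc, rfl⟩ := hP.exists_isCycle hk
      have hce : s(a, b) ∈ c.edges := by
        rw [← Walk.mem_edges_toSubgraph, ← hPe]; exact hf _ hP
      have hcE : ∀ e ∈ c.edges, e ∈ c.toSubgraph.spanningCoe.edgeSet := by
        intro e he
        rwa [Subgraph.edgeSet_spanningCoe, Walk.mem_edges_toSubgraph]
      have hb : ¬ c.toSubgraph.spanningCoe.IsBridge s(a, b) := fun hb =>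
        hb.notMem_edges_of_isCycle (hc.transfer hcE) (by rwa [Walk.edges_transfer])
      -- The deleted edge is bypassed along the rest of its polygon, which loses no other edge.
      rw [isBridge_iff, not_not] at hb
      refine hb.mono fun x y hxy => ?_
      rw [deleteEdges_adj] at hxy
      rw [hT, deleteEdges_adj]
      refine ⟨c.toSubgraph.adj_sub hxy.1, ?_⟩
      rintro ⟨Q, hQ, hQe⟩
      have hQP := hinj _ hP Q hQ (by rw [hQe]; exact hxy.1)
      exact hxy.2 (by rw [← hQe, hQP, hPe]; rfl)
    · exact (deleteEdges_adj.2 ⟨hab, hS⟩ : T.Adj a b).reachable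
  have hconn : T.Connected := by
    have := hG.1.nonempty
    refine ⟨fun x y => ?_⟩
    obtain ⟨p⟩ := hG.1.preconnected x y
    induction p with
    | nil => rfl
    | cons h q ih => exact (hadj _ _ h).trans ih
  -- A surviving cycle would be a polygon of `G`, yet each polygon has lost an edge.
  refine ⟨hconn, fun u c hc => ?_⟩
  have hle : T ≤ G := deleteEdges_le _
  have hc' : (c.mapLe hle).IsCycle := hc.mapLe hle
  have hP := hG.isPolygon_of_isCycle hk hc'
  have he := hf _ hP
  rw [Walk.mem_edges_toSubgraph, Walk.edges_mapLe_eq_edges] at he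
  have heT := c.edges_subset_edgeSet he
  have heS := (edgeSet_deleteEdges (G := G) _ ▸ heT :
    _ ∈ G.edgeSet \ f '' {P | IsPolygon G k P})
  exact heS.2 ⟨_, hP, rfl⟩

lemma card_add_ncard [Fintype V] (hk : 3 ≤ k) (hG : IsPolygonalCactus k G) :
    Fintype.card V + {P : G.Subgraph | IsPolygon G k P}.ncard =
      {P : G.Subgraph | IsPolygon G k P}.ncard * k + 1 := by
  classical
  have hne : ∀ P : G.Subgraph, IsPolygon G k P → ∃ e, e ∈ P.edgeSet := fun P hP =>
    Set.nonempty_of_ncard_ne_zero (by rw [hP.ncard_edgeSet hk]; omega)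
  -- An arbitrary value for `f` on subgraphs that are not polygons.
  have := hG.1.nonempty.map fun v : V => s(v, v)
  choose! f hf using hne
  have htree := (hG.isTree_deleteEdges hk hf).card_edgeFinset
  have hinj : Set.InjOn f {P | IsPolygon G k P} := by
    intro P hP Q hQ h
    have h1 := hf P hP
    have h2 := hf Q hQ
    rw [← h] at h2
    revert h1 h2
    generalize f P = e
    induction e with
    | _ a b =>
      intro h1 h2
      exact (hG.existsUnique_isPolygon_adj hk (P.adj_sub h1)).unique ⟨hP, h1⟩ ⟨hQ, h2⟩
  have hS := hinj.ncard_image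
  have hsub : f '' {P | IsPolygon G k P} ⊆ G.edgeSet := by
    rintro _ ⟨P, hP, rfl⟩
    exact P.edgeSet_subset (hf P hP)
  have hE := hG.card_edgeFinset hk
  have hdiff := Set.ncard_sdiff_add_ncard_of_subset hsub (Set.toFinite _)
  rw [← edgeSet_deleteEdges, ← coe_edgeFinset, ← coe_edgeFinset G, Set.ncard_coe_finset,
    Set.ncard_coe_finset, hE, hS] at hdiff
  omega

end IsPolygonalCactus
end Counting
-- Convexity inequalities for edges and triangles.
section Weights

/-- Increments of a convex function of a sum grow with the other summand. -/
lemma convexOn_add_le_add {h : ℝ → ℝ} (hh : ConvexOn ℝ (Set.Ici 0) h) {p p' q q' : ℝ}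
    (hp : 0 ≤ p) (hpp : p ≤ p') (hq : 0 ≤ q) (hqq : q ≤ q') :
    h (p' + q) + h (p + q') ≤ h (p' + q') + h (p + q) := by
  rcases eq_or_lt_of_le hpp with rfl | hlt
  · linarith
  have hd : 0 < (p' - p) + (q' - q) := by linarith
  have hx : p + q ∈ Set.Ici (0 : ℝ) := Set.mem_Ici.2 (by linarith)
  have hy : p' + q' ∈ Set.Ici (0 : ℝ) := Set.mem_Ici.2 (by linarith)
  -- The two mixed sums are convex combinations of the extreme sums with swapped weights `s` and
  -- `t`; the two convexity inequalities add up to the claim.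
  set s := (p' - p) / ((p' - p) + (q' - q)) with hs
  set t := (q' - q) / ((p' - p) + (q' - q)) with ht
  have hs0 : 0 ≤ s := div_nonneg (by linarith) hd.le
  have ht0 : 0 ≤ t := div_nonneg (by linarith) hd.le
  have hst : s + t = 1 := by rw [hs, ht, ← add_div, div_self hd.ne']
  have hsd : s * ((p' - p) + (q' - q)) = p' - p := div_mul_cancel₀ _ hd.ne'
  have h1 := hh.2 hx hy ht0 hs0 (by linarith)
  have h2 := hh.2 hx hy hs0 ht0 hst
  simp only [smul_eq_mul] at h1 h2
  have ht' : t = 1 - s := by linarith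
  have e1 : t * (p + q) + s * (p' + q') = p' + q := by rw [ht']; linear_combination hsd
  have e2 : s * (p + q) + t * (p' + q') = p + q' := by rw [ht']; linear_combination -hsd
  rw [e1] at h1
  rw [e2] at h2
  have : (t * h (p + q) + s * h (p' + q')) + (s * h (p + q) + t * h (p' + q'))
      = h (p' + q') + h (p + q) := by rw [ht']; ring
  linarith

/-- The properties of an edge weight, as a function of half the degrees of the two ends, on which
the extremal results rest. -/
structure IsSupermodularWeight (F : ℕ → ℕ → ℝ) : Prop where
  symm : ∀ a b, F a b = F b a
  mono : ∀ {a a'} b, a ≤ a' → F a b ≤ F a' b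
  super : ∀ {a a' b b'}, a ≤ a' → b ≤ b' → F a' b + F a b' ≤ F a' b' + F a b
  one_two : F 1 1 < F 1 2
  mid : 2 * F 1 2 < F 1 1 + F 2 2
  two_two_le : F 2 2 ≤ F 1 3

/-- The weight of an edge whose ends have degrees `2 * a` and `2 * b`. -/
noncomputable def edgeWeight (α β : ℝ) (a b : ℕ) : ℝ :=
  ((2 * a : ℝ) ^ α + (2 * b : ℝ) ^ α) ^ β

/-- `super` and `mid` come from convexity of `t ^ β`, strict for `mid`; `two_two_le` comes from
convexity of `t ^ α` at the midpoint 4 of 2 and 6. -/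
lemma isSupermodularWeight_edgeWeight {α β : ℝ} (hα : 1 ≤ α) (hβ : 1 < β) :
    IsSupermodularWeight (edgeWeight α β) := by
  have hα0 : 0 < α := by linarith
  have hβ0 : 0 < β := by linarith
  have hx0 : ∀ a : ℕ, 0 ≤ (2 * a : ℝ) ^ α := fun a => by positivity
  have hxm : ∀ {a a' : ℕ}, a ≤ a' → (2 * a : ℝ) ^ α ≤ (2 * a' : ℝ) ^ α := fun h => by
    gcongr
  have hlt : (2 * (1 : ℕ) : ℝ) ^ α < (2 * (2 : ℕ) : ℝ) ^ α :=
    Real.rpow_lt_rpow (by norm_num) (by norm_num) hα0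
  have hconv := strictConvexOn_rpow hβ
  have h3 : (2 * (2 : ℕ) : ℝ) ^ α + (2 * (2 : ℕ) : ℝ) ^ α ≤
      (2 * (1 : ℕ) : ℝ) ^ α + (2 * (3 : ℕ) : ℝ) ^ α := by
    have h := (convexOn_rpow hα).2 (show (2 : ℝ) ∈ Set.Ici 0 by simp) (show (6 : ℝ) ∈ Set.Ici 0 by simp)
      (show (0 : ℝ) ≤ 1 / 2 by norm_num) (show (0 : ℝ) ≤ 1 / 2 by norm_num) (by norm_num)
    norm_num at h ⊢
    linarith
  refine ⟨fun a b => ?_, fun b h => ?_, fun ha hb => ?_, ?_, ?_, ?_⟩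
  · rw [edgeWeight, edgeWeight, add_comm]
  · exact Real.rpow_le_rpow (add_nonneg (hx0 _) (hx0 _)) (by linarith [hxm h]) hβ0.le
  · exact convexOn_add_le_add hconv.convexOn (hx0 _) (hxm ha) (hx0 _) (hxm hb)
  · exact Real.rpow_lt_rpow (add_nonneg (hx0 _) (hx0 _)) (by linarith) hβ0
  · have h := hconv.2 (Set.mem_Ici.2 (add_nonneg (hx0 1) (hx0 1)))
      (Set.mem_Ici.2 (add_nonneg (hx0 2) (hx0 2))) (by linarith)
      (show (0 : ℝ) < 1 / 2 by norm_num) (show (0 : ℝ) < 1 / 2 by norm_num) (by norm_num)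
    simp only [smul_eq_mul] at h
    have e : (1 / 2 : ℝ) * ((2 * (1 : ℕ) : ℝ) ^ α + (2 * (1 : ℕ) : ℝ) ^ α) +
        1 / 2 * ((2 * (2 : ℕ) : ℝ) ^ α + (2 * (2 : ℕ) : ℝ) ^ α) =
        (2 * (1 : ℕ) : ℝ) ^ α + (2 * (2 : ℕ) : ℝ) ^ α := by ring
    rw [e] at h
    have hdouble : ∀ x y z : ℝ, x < 1 / 2 * y + 1 / 2 * z → 2 * x < y + z := by
      intro x y z h; linarith
    exact hdouble _ _ _ h
  · exact Real.rpow_le_rpow (add_nonneg (hx0 _) (hx0 _)) h3 hβ0.le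

/-- The excess `1 - 1 / a` of a vertex lying on `a` polygons. -/
noncomputable def excess (a : ℕ) : ℝ := 1 - 1 / a

@[simp] lemma excess_one : excess 1 = 0 := by norm_num [excess]

@[simp] lemma excess_two : excess 2 = 1 / 2 := by norm_num [excess]

lemma excess_lt_one {a : ℕ} (ha : 1 ≤ a) : excess a < 1 := by
  have : (0 : ℝ) < 1 / a := by positivity
  unfold excess
  linarith

/-- The amount by which the weight of a triangle whose vertices lie on `a`, `b`, `c` polygons exceeds
the affine function of the total excess that interpolates the triangles `1, 1, 2` and `1, 2, 2`. -/
noncomputable def triangleGap (F : ℕ → ℕ → ℝ) (a b c : ℕ) : ℝ :=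
  F a b + F b c + F a c - (2 * F 1 2 - F 2 2 + 2 * F 1 1) -
    2 * (F 2 2 - F 1 1) * (excess a + excess b + excess c)

namespace IsSupermodularWeight

variable {F : ℕ → ℕ → ℝ} (hF : IsSupermodularWeight F)
include hF

lemma mono_right {b b' : ℕ} (a : ℕ) (h : b ≤ b') : F a b ≤ F a b' := by
  rw [hF.symm a b, hF.symm a b']
  exact hF.mono a h

/-- The excess stays below 1, and already `F 1 3 ≥ F 2 2 > F 1 1 + 2 * (F 1 2 - F 1 1)`. -/
lemma pendant_lt {a : ℕ} (ha : 3 ≤ a) :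
    F 1 1 + 2 * (F 1 2 - F 1 1) * excess a < F 1 a := by
  have h1 := hF.mono_right 1 ha
  have h2 := hF.mid
  have h3 := hF.two_two_le
  have h4 := hF.one_two
  have h5 := mul_lt_mul_of_pos_left (excess_lt_one (by omega : 1 ≤ a))
    (by linarith : 0 < 2 * (F 1 2 - F 1 1))
  linarith

lemma pendant_le {a : ℕ} (ha : 1 ≤ a) :
    F 1 1 + 2 * (F 1 2 - F 1 1) * excess a ≤ F 1 a := by
  rcases (by omega : a = 1 ∨ a = 2 ∨ 3 ≤ a) with rfl | rfl | h
  · simp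
  · rw [excess_two]; linarith
  · exact (hF.pendant_lt h).le

/-- Supermodularity, `F a b + F 1 1 ≥ F a 1 + F 1 b`, reduces to pendant pairs; strictness comes
from `pendant_lt`, or from `mid` at the pair `2, 2`. -/
lemma edge_lt {a b : ℕ} (ha : 1 ≤ a) (hb : 1 ≤ b) (h : 3 ≤ a ∨ 3 ≤ b ∨ 2 ≤ a ∧ 2 ≤ b) :
    F 1 1 + 2 * (F 1 2 - F 1 1) * (excess a + excess b) < F a b := by
  have hs := hF.super ha hb
  rw [hF.symm a 1] at hs
  have h1 := hF.pendant_le ha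
  have h2 := hF.pendant_le hb
  by_cases h3 : 3 ≤ a
  · linarith [hF.pendant_lt h3]
  by_cases h4 : 3 ≤ b
  · linarith [hF.pendant_lt h4]
  obtain rfl : a = 2 := by omega
  obtain rfl : b = 2 := by omega
  have := hF.mid
  rw [excess_two]
  linarith

lemma edge_eq {a b : ℕ} (ha : 1 ≤ a) (hb : 1 ≤ b) (h : ¬ (3 ≤ a ∨ 3 ≤ b ∨ 2 ≤ a ∧ 2 ≤ b)) :
    F 1 1 + 2 * (F 1 2 - F 1 1) * (excess a + excess b) = F a b := by
  have hc : a = 1 ∧ b = 1 ∨ a = 1 ∧ b = 2 ∨ a = 2 ∧ b = 1 := by omega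
  rcases hc with ⟨rfl, rfl⟩ | ⟨rfl, rfl⟩ | ⟨rfl, rfl⟩
  · simp
  · rw [excess_one, excess_two]; ring
  · rw [hF.symm 2 1, excess_one, excess_two]; ring

/-- Raising a vertex from 2 to `a` adds to each of its two edges at least `F 1 3 - F 1 2 ≥ F 2 2 - F
1 2 > (F 2 2 - F 1 1) / 2`, while its excess grows by less than 1/2. -/
lemma triangle_step {a b c : ℕ} (ha : 3 ≤ a) (hb : 1 ≤ b) (hc : 1 ≤ c) :
    F 2 b + F 2 c + 2 * (F 2 2 - F 1 1) * (excess a - 1 / 2) < F a b + F a c := by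
  have hm := hF.mid
  have h12 := hF.one_two
  have key : ∀ {b : ℕ}, 1 ≤ b → (F 2 2 - F 1 1) / 2 < F a b - F 2 b := by
    intro b hb
    have h1 := hF.mono b ha
    have h2 := hF.super (by omega : 2 ≤ 3) hb
    have h3 := hF.two_two_le
    rw [hF.symm 3 1, hF.symm 2 1] at h2
    linarith
  have h5 := mul_lt_mul_of_pos_left (excess_lt_one (by omega : 1 ≤ a))
    (by linarith : 0 < 2 * (F 2 2 - F 1 1))
  linarith [key hb, key hc]

lemma triangleGap_le_min {a b c : ℕ} (hb : 1 ≤ b) (hc : 1 ≤ c) :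
    triangleGap F (min a 2) b c ≤ triangleGap F a b c := by
  rcases le_or_gt a 2 with h | h
  · rw [min_eq_left h]
  · have := hF.triangle_step h hb hc
    rw [min_eq_right h.le]
    simp only [triangleGap, excess_two]
    linarith

lemma triangleGap_rotate (a b c : ℕ) : triangleGap F a b c = triangleGap F b c a := by
  simp only [triangleGap]
  rw [hF.symm b a, hF.symm c a]
  ring

lemma triangleGap_nonneg {a b c : ℕ} (ha : 1 ≤ a) (hb : 1 ≤ b) (hc : 1 ≤ c) :
    0 ≤ triangleGap F a b c := by
  have hsmall : ∀ {a b c : ℕ}, 1 ≤ a → 1 ≤ b → 1 ≤ c → a ≤ 2 → b ≤ 2 → c ≤ 2 →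
      0 ≤ triangleGap F a b c := by
    intro a b c ha hb hc ha' hb' hc'
    have hm := hF.mid
    have hs := hF.symm 2 1
    simp only [triangleGap]
    interval_cases a <;> interval_cases b <;> interval_cases c <;>
      simp only [excess_one, excess_two] <;> linarith
  have hmin : ∀ {a : ℕ}, 1 ≤ a → 1 ≤ min a 2 := fun h => le_min h (by norm_num)
  -- Each coordinate is truncated at 2 in turn, rotating the triangle in between; the eight
  -- remaining cases follow from `mid`.
  have h1 := hF.triangleGap_le_min (a := a) hb hc
  have h2 := hF.triangleGap_le_min (a := b) hc (hmin ha)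
  have h3 := hF.triangleGap_le_min (a := c) (hmin ha) (hmin hb)
  have h4 := hsmall (hmin hc) (hmin ha) (hmin hb) (min_le_right _ _) (min_le_right _ _)
    (min_le_right _ _)
  linarith [hF.triangleGap_rotate (min a 2) b c, hF.triangleGap_rotate (min b 2) c (min a 2)]

lemma triangleGap_pos {a b c : ℕ} (ha : 3 ≤ a) (hb : 1 ≤ b) (hc : 1 ≤ c) :
    0 < triangleGap F a b c := by
  have h1 := hF.triangle_step ha hb hc
  have h2 := hF.triangleGap_nonneg (by norm_num : 1 ≤ 2) hb hc
  simp only [triangleGap, excess_two] at h2 ⊢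
  linarith

/-- The gap vanishes exactly on the triangles with one or two vertices on two polygons and the
others on one. -/
lemma triangleGap_eq_zero_iff {a b c : ℕ} (ha : 1 ≤ a) (hb : 1 ≤ b) (hc : 1 ≤ c) :
    triangleGap F a b c = 0 ↔ a ≤ 2 ∧ b ≤ 2 ∧ c ≤ 2 ∧ (2 ≤ a ∨ 2 ≤ b ∨ 2 ≤ c) ∧
      ¬ (2 ≤ a ∧ 2 ≤ b ∧ 2 ≤ c) := by
  by_cases h3 : 3 ≤ a ∨ 3 ≤ b ∨ 3 ≤ c
  · have hpos : 0 < triangleGap F a b c := by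
      rcases h3 with h | h | h
      · exact hF.triangleGap_pos h hb hc
      · rw [hF.triangleGap_rotate]
        exact hF.triangleGap_pos h hc ha
      · rw [← hF.triangleGap_rotate]
        exact hF.triangleGap_pos h ha hb
    exact ⟨fun h => absurd h hpos.ne', fun h => by omega⟩
  · have hm := hF.mid
    have hs := hF.symm 2 1
    have ha' : a ≤ 2 := by omega
    have hb' : b ≤ 2 := by omega
    have hc' : c ≤ 2 := by omega
    clear h3
    simp only [triangleGap]
    interval_cases a <;> interval_cases b <;> interval_cases c <;>
      simp only [excess_one, excess_two] <;> norm_num <;> linarith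

end IsSupermodularWeight
end Weights
-- Summing the local bounds over the cactus.
section Sums

variable {V : Type*} {G : SimpleGraph V} {k : ℕ}

lemma sum_edgeFinset_eq_sum_degree_mul [Fintype V] [DecidableEq V] [DecidableRel G.Adj] (f : V → ℝ)
    {g : Sym2 V → ℝ} (hg : ∀ u v, g s(u, v) = f u + f v) :
    ∑ e ∈ G.edgeFinset, g e = ∑ v, G.degree v * f v := by
  have h1 : ∀ e ∈ G.edgeFinset, g e = ∑ v ∈ e.toFinset, f v := by
    intro e he
    induction e with
    | _ a b =>
      have hab : a ≠ b := (mem_edgeFinset.1 he : G.Adj a b).ne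
      rw [hg, Sym2.toFinset_mk_eq, Finset.sum_pair hab]
  rw [Finset.sum_congr rfl h1, Finset.sum_comm' (t' := Finset.univ)
    (s' := fun v => G.incidenceFinset v)]
  · refine Finset.sum_congr rfl fun v _ => ?_
    rw [Finset.sum_const, card_incidenceFinset_eq_degree, nsmul_eq_mul]
  · intro e v
    simp [mem_incidenceFinset, incidenceSet, mem_edgeFinset]

namespace IsPolygonalCactus

lemma exists_adj [Nontrivial V] (hG : IsPolygonalCactus k G) (v : V) : ∃ w, G.Adj v w := by
  obtain ⟨x, hx⟩ := exists_ne v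
  obtain ⟨w, hw, -⟩ := exists_adj_reachable_deleteIncidenceSet hG.1 hx
  exact ⟨w, hw⟩

lemma degree_eq [Fintype V] [DecidableRel G.Adj] (hk : 3 ≤ k) (hG : IsPolygonalCactus k G) (v : V) :
    G.degree v = 2 * polygonCount G k v := by
  rw [← hG.ncard_neighborSet_eq hk, ← card_neighborSet_eq_degree, Set.ncard_eq_toFinset_card',
    Set.toFinset_card]

/-- Each vertex contributes `2a * (1 - 1/a) = d(v) - 2`, so the sum depends only on the numbers of
edges and vertices. -/
lemma sum_edge_excess [Fintype V] [DecidableEq V] [DecidableRel G.Adj] [Nontrivial V] (hk : 3 ≤ k)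
    (hG : IsPolygonalCactus k G) {g : Sym2 V → ℝ}
    (hg : ∀ u v, g s(u, v) = excess (polygonCount G k u) + excess (polygonCount G k v)) :
    ∑ e ∈ G.edgeFinset, g e = 2 * ({P : G.Subgraph | IsPolygon G k P}.ncard - 1) := by
  rw [sum_edgeFinset_eq_sum_degree_mul (fun v => excess (polygonCount G k v)) hg]
  have h1 : ∀ v ∈ Finset.univ, (G.degree v : ℝ) * excess (polygonCount G k v) =
      (G.degree v : ℝ) - 2 := by
    intro v _
    have hb := hG.polygonCount_pos hk v
    rw [hG.degree_eq hk, excess]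
    push_cast
    field_simp
  rw [Finset.sum_congr rfl h1, Finset.sum_sub_distrib, ← Nat.cast_sum,
    G.sum_degrees_eq_twice_card_edges, hG.card_edgeFinset hk]
  have h2 : ((Fintype.card V + {P : G.Subgraph | IsPolygon G k P}.ncard : ℕ) : ℝ) =
    ({P : G.Subgraph | IsPolygon G k P}.ncard * k + 1 : ℕ) := by rw [hG.card_add_ncard hk]
  push_cast at h2 ⊢
  simp only [Finset.sum_const, Finset.card_univ, nsmul_eq_mul]
  linarith

/-- The edgewise lower bound for the total weight of a cactus. -/
lemma sum_weight_ge [Fintype V] [DecidableEq V] [DecidableRel G.Adj] [Nontrivial V] (hk : 3 ≤ k)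
    (hG : IsPolygonalCactus k G) {F : ℕ → ℕ → ℝ} (hF : IsSupermodularWeight F) {w : Sym2 V → ℝ}
    (hw : ∀ u v, w s(u, v) = F (polygonCount G k u) (polygonCount G k v)) {n : ℕ}
    (hn : {P : G.Subgraph | IsPolygon G k P}.ncard = n) :
    k * n * F 1 1 + 4 * (n - 1) * (F 1 2 - F 1 1) ≤ ∑ e ∈ G.edgeFinset, w e ∧
    (∑ e ∈ G.edgeFinset, w e = k * n * F 1 1 + 4 * (n - 1) * (F 1 2 - F 1 1) ↔
      ∀ u v, G.Adj u v → ¬ (3 ≤ polygonCount G k u ∨ 3 ≤ polygonCount G k v ∨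
        2 ≤ polygonCount G k u ∧ 2 ≤ polygonCount G k v)) := by
  set g : Sym2 V → ℝ := Sym2.lift ⟨fun u v => excess (polygonCount G k u) +
    excess (polygonCount G k v), fun u v => add_comm _ _⟩ with hg
  have hg' : ∀ u v, g s(u, v) = excess (polygonCount G k u) + excess (polygonCount G k v) :=
    fun u v => rfl
  have hsum : ∑ e ∈ G.edgeFinset, (F 1 1 + 2 * (F 1 2 - F 1 1) * g e) =
      k * n * F 1 1 + 4 * (n - 1) * (F 1 2 - F 1 1) := by
    rw [Finset.sum_add_distrib, ← Finset.mul_sum, hG.sum_edge_excess hk hg', hn, Finset.sum_const,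
      hG.card_edgeFinset hk, hn, nsmul_eq_mul]
    push_cast
    ring
  have hpos := hG.polygonCount_pos hk
  have hle : ∀ e ∈ G.edgeFinset, F 1 1 + 2 * (F 1 2 - F 1 1) * g e ≤ w e := by
    intro e _
    induction e with
    | _ a b =>
      rw [hg', hw]
      by_cases h : 3 ≤ polygonCount G k a ∨ 3 ≤ polygonCount G k b ∨
        2 ≤ polygonCount G k a ∧ 2 ≤ polygonCount G k b
      · exact (hF.edge_lt (hpos a) (hpos b) h).le
      · exact (hF.edge_eq (hpos a) (hpos b) h).le
  rw [← hsum]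
  refine ⟨Finset.sum_le_sum hle, ?_⟩
  rw [eq_comm, Finset.sum_eq_sum_iff_of_le hle]
  constructor
  · intro h u v huv hcon
    have := h s(u, v) (mem_edgeFinset.2 huv)
    rw [hg', hw] at this
    exact (hF.edge_lt (hpos u) (hpos v) hcon).ne this
  · intro h e he
    induction e with
    | _ a b =>
      rw [hg', hw]
      exact hF.edge_eq (hpos a) (hpos b) (h a b (mem_edgeFinset.1 he))

end IsPolygonalCactus

lemma IsPolygon.adj_of_ne {P : G.Subgraph} (hP : IsPolygon G 3 P) {a b : V} (ha : a ∈ P.verts)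
    (hb : b ∈ P.verts) (hab : a ≠ b) : P.Adj a b := by
  obtain ⟨e⟩ := hP
  have h : P.coe.Adj ⟨a, ha⟩ ⟨b, hb⟩ := by
    have hne : e ⟨a, ha⟩ ≠ e ⟨b, hb⟩ := fun h => hab (congrArg Subtype.val (e.injective h))
    have htop : ∀ i j : Fin 3, i ≠ j → (cycleGraph 3).Adj i j := by
      rw [cycleGraph_three_eq_top]
      exact fun i j => id
    exact e.map_adj_iff.1 (htop _ _ hne)
  exact h

lemma IsPolygon.exists_triangle {P : G.Subgraph} (hP : IsPolygon G 3 P) :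
    ∃ x y z, x ≠ y ∧ y ≠ z ∧ x ≠ z ∧ P.verts = {x, y, z} ∧
      P.edgeSet = {s(x, y), s(y, z), s(x, z)} := by
  obtain ⟨x, y, z, hxy, hxz, hyz, hverts⟩ := Set.ncard_eq_three.1 hP.ncard_verts
  refine ⟨x, y, z, hxy, hyz, hxz, hverts, ?_⟩
  have hx : x ∈ P.verts := by simp [hverts]
  have hy : y ∈ P.verts := by simp [hverts]
  have hz : z ∈ P.verts := by simp [hverts]
  ext e
  induction e with
  | _ a b =>
    constructor
    · intro h
      have hab : P.Adj a b := h
      have ha := P.edge_vert hab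
      have hb := P.edge_vert hab.symm
      have hne := hab.ne
      rw [hverts] at ha hb
      simp only [Set.mem_insert_iff, Set.mem_singleton_iff] at ha hb ⊢
      rcases ha with rfl | rfl | rfl <;> rcases hb with rfl | rfl | rfl <;> simp_all [Sym2.eq_swap]
    · rintro (h | h | h) <;> rw [h]
      · exact hP.adj_of_ne hx hy hxy
      · exact hP.adj_of_ne hy hz hyz
      · exact hP.adj_of_ne hx hz hxz

namespace IsPolygonalCactus

/-- The trianglewise lower bound for the total weight of a triangular cactus. -/
lemma sum_weight_ge_of_three [Fintype V] [DecidableEq V] [DecidableRel G.Adj] [Nontrivial V]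
    (hG : IsPolygonalCactus 3 G) {F : ℕ → ℕ → ℝ} (hF : IsSupermodularWeight F) {w : Sym2 V → ℝ}
    (hw : ∀ u v, w s(u, v) = F (polygonCount G 3 u) (polygonCount G 3 v)) {n : ℕ}
    (hn : {P : G.Subgraph | IsPolygon G 3 P}.ncard = n) :
    2 * F 1 1 + 2 * n * F 1 2 + (n - 2) * F 2 2 ≤ ∑ e ∈ G.edgeFinset, w e ∧
    (∑ e ∈ G.edgeFinset, w e = 2 * F 1 1 + 2 * n * F 1 2 + (n - 2) * F 2 2 ↔
      ∀ P : G.Subgraph, IsPolygon G 3 P → (∀ v ∈ P.verts, polygonCount G 3 v ≤ 2) ∧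
        (∃ v ∈ P.verts, 2 ≤ polygonCount G 3 v) ∧ ∃ v ∈ P.verts, ¬ 2 ≤ polygonCount G 3 v) := by
  set g : Sym2 V → ℝ := Sym2.lift ⟨fun u v => excess (polygonCount G 3 u) +
    excess (polygonCount G 3 v), fun u v => add_comm _ _⟩ with hg
  have hg' : ∀ u v, g s(u, v) = excess (polygonCount G 3 u) + excess (polygonCount G 3 v) :=
    fun u v => rfl
  -- The slope is half that of `triangleGap`, since each vertex of a triangle is an end of two of
  -- its edges.
  set gap : G.Subgraph → ℝ := fun P =>
    ∑ e ∈ (Set.toFinite P.edgeSet).toFinset, (w e - (F 2 2 - F 1 1) * g e) -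
      (2 * F 1 2 - F 2 2 + 2 * F 1 1) with hgap
  have hpos := hG.polygonCount_pos le_rfl
  have hgap_eq : ∀ P, IsPolygon G 3 P → ∃ x y z, P.verts = {x, y, z} ∧
      gap P = triangleGap F (polygonCount G 3 x) (polygonCount G 3 y) (polygonCount G 3 z) := by
    intro P hP
    obtain ⟨x, y, z, hxy, hyz, hxz, hv, he⟩ := hP.exists_triangle
    refine ⟨x, y, z, hv, ?_⟩
    have hfin : (Set.toFinite P.edgeSet).toFinset = {s(x, y), s(y, z), s(x, z)} := by
      ext e
      rw [Set.Finite.mem_toFinset, he]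
      simp
    have h1 : s(x, y) ∉ ({s(y, z), s(x, z)} : Finset (Sym2 V)) := by
      simp [hxy, hyz, hxz]
    have h2 : s(y, z) ≠ s(x, z) := by simp [hxy.symm, hyz]
    simp only [hgap]
    rw [hfin, Finset.sum_insert h1, Finset.sum_pair h2]
    simp only [hg', hw, triangleGap]
    ring
  have htotal : ∑ e ∈ G.edgeFinset, w e - (2 * F 1 1 + 2 * n * F 1 2 + (n - 2) * F 2 2) =
      ∑ P ∈ (Set.toFinite {P : G.Subgraph | IsPolygon G 3 P}).toFinset, gap P := by
    simp only [hgap]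
    rw [Finset.sum_sub_distrib, ← hG.sum_edgeFinset_eq le_rfl, Finset.sum_sub_distrib,
      ← Finset.mul_sum, hG.sum_edge_excess le_rfl hg', hn, Finset.sum_const,
      ← Set.ncard_eq_toFinset_card, hn, nsmul_eq_mul]
    ring
  have hnn : ∀ P ∈ (Set.toFinite {P : G.Subgraph | IsPolygon G 3 P}).toFinset, 0 ≤ gap P := by
    intro P hP
    obtain ⟨x, y, z, -, h⟩ := hgap_eq P (by simpa using hP)
    rw [h]
    exact hF.triangleGap_nonneg (hpos x) (hpos y) (hpos z)
  refine ⟨by linarith [Finset.sum_nonneg hnn], ?_⟩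
  rw [← sub_eq_zero, htotal, Finset.sum_eq_zero_iff_of_nonneg hnn]
  refine forall_congr' fun P => ?_
  rw [Set.Finite.mem_toFinset]
  refine forall_congr' fun hP => ?_
  obtain ⟨x, y, z, hv, h⟩ := hgap_eq P hP
  rw [h, hF.triangleGap_eq_zero_iff (hpos x) (hpos y) (hpos z), hv]
  simp only [Set.mem_insert_iff, Set.mem_singleton_iff, forall_eq_or_imp, forall_eq,
    exists_eq_or_imp, exists_eq_left]
  tauto

end IsPolygonalCactus
end Sums

/-! ### Equality cases as cactus chains. -/

section Chains

variable {V : Type*} [Finite V] {G : SimpleGraph V} {k : ℕ}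

namespace IsPolygonalCactus

/-- A polygon without cut vertices is the only polygon. -/
lemma eq_of_forall_polygonCount_le_one (hk : 3 ≤ k) (hG : IsPolygonalCactus k G) {P Q : G.Subgraph}
    (hP : IsPolygon G k P) (hQ : IsPolygon G k Q)
    (h : ∀ v ∈ P.verts, polygonCount G k v ≤ 1) : Q = P := by
  have hone : ∀ v ∈ P.verts, ∀ R, IsPolygon G k R → v ∈ R.verts → R = P := fun v hv R hR hvR =>
    (Set.ncard_le_one_iff (Set.toFinite _)).1 (h v hv) ⟨hR, hvR⟩ ⟨hP, hv⟩
  have hwalk : ∀ x y, ∀ _ : G.Walk x y, x ∈ P.verts → y ∈ P.verts := by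
    intro x y p
    induction p with
    | nil => exact id
    | cons hxy q ih =>
      intro hx
      obtain ⟨R, ⟨hR, hRxy⟩, -⟩ := hG.existsUnique_isPolygon_adj hk hxy
      have hRP := hone _ hx R hR (R.edge_vert hRxy)
      exact ih (hRP ▸ R.edge_vert hRxy.symm)
  have hne : ∀ R, IsPolygon G k R → R.verts.Nonempty := fun R hR =>
    Set.nonempty_of_ncard_ne_zero (by rw [hR.ncard_verts]; omega)
  obtain ⟨x, hx⟩ := hne P hP
  obtain ⟨y, hy⟩ := hne Q hQ
  obtain ⟨p⟩ := hG.1.preconnected x y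
  exact hone y (hwalk _ _ p hx) Q hQ hy

/-- Adjacency is automatic in a triangle, and having at most two cut vertices means having a vertex
that is not one. A cut vertex exists in each triangle because there are at least two polygons. -/
lemma mem_adjacentChains_iff [Nontrivial V] {n : ℕ} (hn : 2 ≤ n) (hG : G ∈ polygonalCacti V n 3) :
    G ∈ adjacentChains V n 3 ↔
      ∀ P : G.Subgraph, IsPolygon G 3 P → (∀ v ∈ P.verts, polygonCount G 3 v ≤ 2) ∧
        (∃ v ∈ P.verts, 2 ≤ polygonCount G 3 v) ∧ ∃ v ∈ P.verts, ¬ 2 ≤ polygonCount G 3 v := by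
  have hC : IsPolygonalCactus 3 G := hG.1
  constructor
  · rintro ⟨-, ⟨-, hcut, htwo⟩, -⟩ P hP
    refine ⟨fun v _ => ?_, ?_, ?_⟩
    · by_contra! h
      have := htwo v ((hC.isCutVertex_iff le_rfl v).2 (by omega))
      rw [← polygonCount] at this
      omega
    · by_contra! h
      have hall : ∀ Q R : G.Subgraph, IsPolygon G 3 Q → IsPolygon G 3 R → Q = R := by
        intro Q R hQ hR
        have h' : ∀ v ∈ P.verts, polygonCount G 3 v ≤ 1 := fun v hv => by
          have := h v hv; omega
        rw [hC.eq_of_forall_polygonCount_le_one le_rfl hP hQ h',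
          hC.eq_of_forall_polygonCount_le_one le_rfl hP hR h']
      have : {P : G.Subgraph | IsPolygon G 3 P}.ncard ≤ 1 :=
        (Set.ncard_le_one_iff (Set.toFinite _)).2 fun hQ hR => hall _ _ hQ hR
      rw [hG.2] at this
      omega
    · obtain ⟨v, hv, hv'⟩ := Set.exists_mem_notMem_of_ncard_lt_ncard
        (s := {v | v ∈ P.verts ∧ IsCutVertex G v}) (t := P.verts)
        (by rw [hP.ncard_verts]; have := hcut P hP; omega)
      exact ⟨v, hv, fun h => hv' ⟨hv, (hC.isCutVertex_iff le_rfl v).2 h⟩⟩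
  · intro h
    refine ⟨hG, ⟨hC, fun P hP => ?_, fun v hv => ?_⟩, fun P hP u hu v hv _ _ huv =>
      P.adj_sub (hP.adj_of_ne hu hv huv)⟩
    · obtain ⟨v, hv, hv'⟩ := (h P hP).2.2
      have : {v | v ∈ P.verts ∧ IsCutVertex G v}.ncard < P.verts.ncard := by
        refine Set.ncard_lt_ncard ⟨fun x hx => hx.1, fun hsub => hv' ?_⟩ (Set.toFinite _)
        exact (hC.isCutVertex_iff le_rfl v).1 (hsub hv).2
      rw [hP.ncard_verts] at this
      omega
    · have h2 := (hC.isCutVertex_iff le_rfl v).1 hv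
      obtain ⟨w, hw⟩ := hC.exists_adj v
      obtain ⟨P, ⟨hP, hPw⟩, -⟩ := hC.existsUnique_isPolygon_adj le_rfl hw
      exact le_antisymm ((h P hP).1 v (P.edge_vert hPw)) h2

lemma polygonCount_of_mem_nonadjacentChains {n : ℕ} (hk : 3 ≤ k)
    (hG : G ∈ nonadjacentChains V n k) (u v : V) (huv : G.Adj u v) :
    ¬ (3 ≤ polygonCount G k u ∨ 3 ≤ polygonCount G k v ∨
        2 ≤ polygonCount G k u ∧ 2 ≤ polygonCount G k v) := by
  obtain ⟨⟨hC, -⟩, ⟨-, -, htwo⟩, hadj⟩ := hG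
  have hcut := hC.isCutVertex_iff hk
  have hle : ∀ x, ¬ 3 ≤ polygonCount G k x := by
    intro x h
    have := htwo x ((hcut x).2 (by omega))
    rw [← polygonCount] at this
    omega
  rintro (h | h | ⟨hu, hv⟩)
  · exact hle u h
  · exact hle v h
  · obtain ⟨P, ⟨hP, hPuv⟩, -⟩ := hC.existsUnique_isPolygon_adj hk huv
    exact hadj P hP u (P.edge_vert hPuv) v (P.edge_vert hPuv.symm) ((hcut u).2 hu) ((hcut v).2 hv)
      huv.ne huv

end IsPolygonalCactus

/-- This is where `k ≤ 5` enters: a hexagon has three pairwise nonadjacent vertices, so equality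
would no longer force a chain. -/
lemma card_le_two_of_forall_not_adj (hk : k = 4 ∨ k = 5) (s : Finset (Fin k))
    (hs : ∀ i ∈ s, ∀ j ∈ s, ¬ (cycleGraph k).Adj i j) : s.card ≤ 2 := by
  rcases hk with rfl | rfl <;> revert s <;> decide

namespace IsPolygonalCactus

lemma mem_nonadjacentChains_iff [Nontrivial V] {n : ℕ} (hk : k = 4 ∨ k = 5)
    (hG : G ∈ polygonalCacti V n k) :
    G ∈ nonadjacentChains V n k ↔ ∀ u v, G.Adj u v →
      ¬ (3 ≤ polygonCount G k u ∨ 3 ≤ polygonCount G k v ∨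
        2 ≤ polygonCount G k u ∧ 2 ≤ polygonCount G k v) := by
  classical
  have hk3 : 3 ≤ k := by omega
  have hC : IsPolygonalCactus k G := hG.1
  have hcut := hC.isCutVertex_iff hk3
  refine ⟨fun h => polygonCount_of_mem_nonadjacentChains hk3 h, fun h => ?_⟩
  refine ⟨hG, ⟨hC, fun P hP => ?_, fun v hv => ?_⟩, fun P _ u _ v _ hu hv _ huv =>
    h u v huv (Or.inr (Or.inr ⟨(hcut u).1 hu, (hcut v).1 hv⟩))⟩
  · obtain ⟨e⟩ := hP
    set s : Finset (Fin k) := {i | IsCutVertex G (e.symm i : V)} with hs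
    have hcard : s.card ≤ 2 := by
      refine card_le_two_of_forall_not_adj hk s fun i hi j hj hij => ?_
      rw [hs, Finset.mem_filter] at hi hj
      have hadj : P.coe.Adj (e.symm i) (e.symm j) := e.symm.map_adj_iff.2 hij
      exact h _ _ (P.adj_sub hadj) (Or.inr (Or.inr ⟨(hcut _).1 hi.2, (hcut _).1 hj.2⟩))
    have hsub : {v | v ∈ P.verts ∧ IsCutVertex G v} ⊆ (fun i => (e.symm i : V)) '' s := by
      rintro v ⟨hv, hv'⟩
      refine ⟨e ⟨v, hv⟩, ?_, by simp⟩
      simp [hs, hv']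
    calc {v | v ∈ P.verts ∧ IsCutVertex G v}.ncard
        ≤ ((fun i => (e.symm i : V)) '' (s : Set (Fin k))).ncard := Set.ncard_le_ncard hsub
      _ ≤ (s : Set (Fin k)).ncard := Set.ncard_image_le
      _ = s.card := Set.ncard_coe_finset s
      _ ≤ 2 := hcard
  · have h2 := (hcut v).1 hv
    obtain ⟨w, hw⟩ := hC.exists_adj v
    have h3 := h v w hw
    rw [← polygonCount]
    omega

end IsPolygonalCactus
end Chains

/-! ### Return to the Sombor index. -/

lemma generalSombor_eq {V : Type*} [Fintype V] [DecidableEq V] {G : SimpleGraph V}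
    [DecidableRel G.Adj] {k : ℕ} (hk : 3 ≤ k) (hG : IsPolygonalCactus k G) (α β : ℝ) :
    ∃ w : Sym2 V → ℝ, generalSombor G α β = ∑ e ∈ G.edgeFinset, w e ∧
      ∀ u v, w s(u, v) = edgeWeight α β (polygonCount G k u) (polygonCount G k v) := by
  refine ⟨_, rfl, fun u v => ?_⟩
  rw [Sym2.lift_mk, edgeWeight]
  simp only [hG.degree_eq hk]
  push_cast
  rfl

end PolygonalCactus

theorem corollary15 {V : Type*} [Fintype V] [DecidableEq V] (G : SimpleGraph V)
    [DecidableRel G.Adj] (n k : ℕ) (α β : ℝ) (hn : 3 ≤ n) (hk : 3 ≤ k) (hα : 1 ≤ α) (hβ : 1 < β)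
    (hG : G ∈ PolygonalCactus.polygonalCacti V n k) :
    (k = 3 →
      2 * ((2 : ℝ) ^ (α + 1)) ^ β + 2 * (n : ℝ) * ((4 : ℝ) ^ α + (2 : ℝ) ^ α) ^ β
          + ((n : ℝ) - 2) * (2 * (4 : ℝ) ^ α) ^ β
        ≤ PolygonalCactus.generalSombor G α β ∧
      (PolygonalCactus.generalSombor G α β =
          2 * ((2 : ℝ) ^ (α + 1)) ^ β + 2 * (n : ℝ) * ((4 : ℝ) ^ α + (2 : ℝ) ^ α) ^ β
            + ((n : ℝ) - 2) * (2 * (4 : ℝ) ^ α) ^ β ↔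
        G ∈ PolygonalCactus.adjacentChains V n 3)) ∧
    (4 ≤ k →
      ((k : ℝ) * n - 4 * n + 4) * ((2 : ℝ) ^ (α + 1)) ^ β
          + (4 * (n : ℝ) - 4) * ((4 : ℝ) ^ α + (2 : ℝ) ^ α) ^ β
        ≤ PolygonalCactus.generalSombor G α β ∧
      (G ∈ PolygonalCactus.nonadjacentChains V n k →
        PolygonalCactus.generalSombor G α β =
          ((k : ℝ) * n - 4 * n + 4) * ((2 : ℝ) ^ (α + 1)) ^ β
            + (4 * (n : ℝ) - 4) * ((4 : ℝ) ^ α + (2 : ℝ) ^ α) ^ β) ∧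
      (k = 4 ∨ k = 5 →
        (PolygonalCactus.generalSombor G α β =
            ((k : ℝ) * n - 4 * n + 4) * ((2 : ℝ) ^ (α + 1)) ^ β
              + (4 * (n : ℝ) - 4) * ((4 : ℝ) ^ α + (2 : ℝ) ^ α) ^ β ↔
          G ∈ PolygonalCactus.nonadjacentChains V n k))) := by
  have hC : PolygonalCactus.IsPolygonalCactus k G := hG.1
  have hV : Nontrivial V := by
    rw [← Fintype.one_lt_card_iff_nontrivial]
    have h := hC.card_add_ncard hk
    rw [hG.2] at h
    nlinarith
  have hF := PolygonalCactus.isSupermodularWeight_edgeWeight hα hβ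
  obtain ⟨w, hw, hwF⟩ := PolygonalCactus.generalSombor_eq hk hC α β
  have h11 : ((2 : ℝ) ^ (α + 1)) ^ β = PolygonalCactus.edgeWeight α β 1 1 := by
    rw [PolygonalCactus.edgeWeight, Real.rpow_add_one (by norm_num)]
    norm_num [mul_two]
  have h12 : ((4 : ℝ) ^ α + (2 : ℝ) ^ α) ^ β = PolygonalCactus.edgeWeight α β 1 2 := by
    rw [PolygonalCactus.edgeWeight, add_comm]
    norm_num
  have h22 : (2 * (4 : ℝ) ^ α) ^ β = PolygonalCactus.edgeWeight α β 2 2 := by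
    rw [PolygonalCactus.edgeWeight, two_mul]
    norm_num
  rw [h11, h12, h22, hw]
  refine ⟨?_, fun hk4 => ?_⟩
  · rintro rfl
    rw [PolygonalCactus.IsPolygonalCactus.mem_adjacentChains_iff (by omega) hG]
    exact hC.sum_weight_ge_of_three hF hwF hG.2
  · obtain ⟨hle, heq⟩ := hC.sum_weight_ge hk hF hwF hG.2
    have e : ((k : ℝ) * n - 4 * n + 4) * PolygonalCactus.edgeWeight α β 1 1 +
        (4 * (n : ℝ) - 4) * PolygonalCactus.edgeWeight α β 1 2 =
        k * n * PolygonalCactus.edgeWeight α β 1 1 + 4 * (n - 1) *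
          (PolygonalCactus.edgeWeight α β 1 2 - PolygonalCactus.edgeWeight α β 1 1) := by ring
    rw [e]
    refine ⟨hle, fun hB => heq.2 ?_, fun hk5 => ?_⟩
    · exact PolygonalCactus.IsPolygonalCactus.polygonCount_of_mem_nonadjacentChains hk hB
    · rw [PolygonalCactus.IsPolygonalCactus.mem_nonadjacentChains_iff hk5 hG]
      exact heq
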